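/- Let $\mathcal{Q}$ be a small quantaloid, i.e. a small category whose hom-sets are complete lattices and whose composition preserves arbitrary suprema in each variable. A small $\mathcal{Q}$-category $(X,a)$ is a set $X$ with an extent $|x|\in\operatorname{ob}\mathcal{Q}$ for each $x\in X$ and arrows $a(x,y):|x|\to|y|$ such that $1_{|x|}\le a(x,x)$ and $a(y,z)\circ a(x,y)\le a(x,z)$ for all $x,y,z\in X$. A $\mathcal{Q}$-functor $f:(X,a)\to(Y,b)$ is a map $f:X\to Y$ with $|f(x)|=|x|$ and $a(x,y)\le b(f(x),f(y))$ for all $x,y\in X$. A $\mathcal{Q}$-distributor $\varphi$ from $(X,a)$ to $(Y,b)$ is a family of arrows $\varphi(x,y):|x|\to|y|$ $(x\in X,\ y\in Y)$ such that $b(y,y')\circ\varphi(x,y)\circ a(x',x)\le\varphi(x',y')$ for all $x,x'\in X$ and $y,y'\in Y$. Let $\mathcal{Q}\text{-}\mathbf{Chu}$ be the category whose objects are the $\mathcal{Q}$-distributors between small $\mathcal{Q}$-categories. A morphism (a $\mathcal{Q}$-Chu transform) from $\varphi$, a distributor from $X$ to $W$, to $\psi$, a distributor from $Y$ to $Z$,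 is a pair $(f,g)$ of $\mathcal{Q}$-functors $f:X\to Y$ and $g:Z\to W$ such that $\psi(f(x),z)=\varphi(x,g(z))$ for all $x\in X$ and $z\in Z$. Composition is $(f',g')\circ(f,g)=(f'\circ f,\;g\circ g')$. A category $\mathcal{C}$ with small hom-sets is called - *totally cocomplete* if a diagram $D:\mathcal{J}\to\mathcal{C}$ has a colimit whenever the colimit of $\mathcal{C}(A,D-):\mathcal{J}\to\mathbf{Set}$ exists in $\mathbf{Set}$ for every object $A$ of $\mathcal{C}$; - *totally complete* if a diagram $D:\mathcal{J}\to\mathcal{C}$ has a limit whenever the colimit of $\mathcal{C}(D-,A):\mathcal{J}^{\mathrm{op}}\to\mathbf{Set}$ exists in $\mathbf{Set}$ for every object $A$ of $\mathcal{C}$; - *hypercomplete* if a diagram $D:\mathcal{J}\to\mathcal{C}$ has a limit whenever the limit of $\mathcal{C}(A,D-):\mathcal{J}\to\mathbf{Set}$ exists in $\mathbf{Set}$ for every object $A$ of $\mathcal{C}$; - *hypercocomplete* if a diagram $D:\mathcal{J}\to\mathcal{C}$ has a colimit whenever the limit of $\mathcal{C}(D-,A):\mathcal{J}^{\mathrm{op}}\to\mathbf{Set}$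 exists in $\mathbf{Set}$ for every object $A$ of $\mathcal{C}$. Here $\mathbf{Set}$ is the category of small sets, and the diagrams $D$ may be of any size (small or large). Then $\mathcal{Q}\text{-}\mathbf{Chu}$ is totally complete and totally cocomplete and, in particular, hypercocomplete and hypercomplete. -/

import Mathlib

open CategoryTheory

universe u w w'

/-- A small quantaloid: a small category whose hom-sets are complete lattices such that composition
preserves arbitrary suprema in each variable. -/
class Quantaloid (Q : Type u) extends Category.{u} Q where
  homLattice (s t : Q) : CompleteLattice (s ⟶ t)
  comp_sSup {r s t : Q} (p : r ⟶ s) (S : Set (s ⟶ t)) : p ≫ sSup S = ⨆ q ∈ S, p ≫ q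
  sSup_comp {r s t : Q} (S : Set (r ⟶ s)) (q : s ⟶ t) : sSup S ≫ q = ⨆ p ∈ S, p ≫ q

namespace Quantaloid

attribute [reducible, instance] Quantaloid.homLattice

section Monotonicity

variable {Q : Type u} [Quantaloid Q]

theorem comp_le_comp {r s t : Q} {p p' : r ⟶ s} {q q' : s ⟶ t} (hp : p ≤ p') (hq : q ≤ q') :
    p ≫ q ≤ p' ≫ q' := by
  have h1 : p ≫ q ≤ p ≫ q' := by
    have h := comp_sSup p {q, q'}
    rw [sSup_pair, sup_eq_right.mpr hq, iSup_pair] at h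
    rw [h]
    exact le_sup_left
  have h2 : p ≫ q' ≤ p' ≫ q' := by
    have h := sSup_comp {p, p'} q'
    rw [sSup_pair, sup_eq_right.mpr hp, iSup_pair] at h
    rw [h]
    exact le_sup_left
  exact h1.trans h2

end Monotonicity

/-- A small `Q`-category: a set of objects, an extent for each object, and hom-arrows
`a(x, y) : |x| ⟶ |y|` with `1 ≤ a(x, x)` and `a(y, z) ∘ a(x, y) ≤ a(x, z)`. -/
structure QCategory (Q : Type u) [Quantaloid Q] : Type (u + 1) where
  Obj : Type u
  extent : Obj → Q
  hom (x y : Obj) : extent x ⟶ extent y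
  id_le (x : Obj) : 𝟙 (extent x) ≤ hom x x
  comp_le (x y z : Obj) : hom x y ≫ hom y z ≤ hom x z

/-- A `Q`-functor: an extent-preserving map with `a(x, y) ≤ b(f x, f y)`. The morphisms `eqToHom`
identify `|x|` with the equal object `|f x|`. -/
@[ext]
structure QFunctor {Q : Type u} [Quantaloid Q] (X Y : QCategory Q) : Type u where
  toFun : X.Obj → Y.Obj
  extent_eq (x : X.Obj) : X.extent x = Y.extent (toFun x)
  hom_le (x y : X.Obj) :
    X.hom x y ≤
      eqToHom (extent_eq x) ≫ Y.hom (toFun x) (toFun y) ≫ eqToHom (extent_eq y).symm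

/-- The identity `Q`-functor. -/
def QFunctor.id {Q : Type u} [Quantaloid Q] (X : QCategory Q) : QFunctor X X where
  toFun x := x
  extent_eq _ := rfl
  hom_le x y := by simp

/-- The composite `Q`-functor `g ∘ f`. -/
def QFunctor.comp {Q : Type u} [Quantaloid Q] {X Y Z : QCategory Q}
    (f : QFunctor X Y) (g : QFunctor Y Z) : QFunctor X Z where
  toFun x := g.toFun (f.toFun x)
  extent_eq x := (f.extent_eq x).trans (g.extent_eq (f.toFun x))
  hom_le x y := by
    refine (f.hom_le x y).trans ?_
    refine (comp_le_comp le_rfl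
      (comp_le_comp (g.hom_le (f.toFun x) (f.toFun y)) le_rfl)).trans (le_of_eq ?_)
    simp

/-- A `Q`-distributor `φ` from `X` to `Y`: arrows `φ(x, y) : |x| ⟶ |y|` with
`b(y, y') ∘ φ(x, y) ∘ a(x', x) ≤ φ(x', y')`. -/
structure QDistributor {Q : Type u} [Quantaloid Q] (X Y : QCategory Q) : Type u where
  arrow (x : X.Obj) (y : Y.Obj) : X.extent x ⟶ Y.extent y
  comp_le (x x' : X.Obj) (y y' : Y.Obj) :
    X.hom x' x ≫ arrow x y ≫ Y.hom y y' ≤ arrow x' y'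

/-- An object of `Q`-Chu: a `Q`-distributor between small `Q`-categories. -/
structure QChu (Q : Type u) [Quantaloid Q] : Type (u + 1) where
  dom : QCategory Q
  cod : QCategory Q
  dist : QDistributor dom cod

/-- A `Q`-Chu transform from `φ : X → W` to `ψ : Y → Z` (distributors): a pair of `Q`-functors
`f : X → Y` and `g : Z → W` with `ψ(f x, z) = φ(x, g z)`, where equal extents are identified. -/
@[ext]
structure ChuTransform {Q : Type u} [Quantaloid Q] (φ ψ : QChu Q) : Type u where
  f : QFunctor φ.dom ψ.dom
  g : QFunctor ψ.cod φ.cod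
  comm (x : φ.dom.Obj) (z : ψ.cod.Obj) :
    eqToHom (f.extent_eq x) ≫ ψ.dist.arrow (f.toFun x) z =
      φ.dist.arrow x (g.toFun z) ≫ eqToHom (g.extent_eq z).symm

/-- The category `Q`-Chu; composition is composition of `Q`-functors in both components. -/
instance QChu.category (Q : Type u) [Quantaloid Q] : Category.{u} (QChu Q) where
  Hom φ ψ := ChuTransform φ ψ
  id φ :=
    { f := QFunctor.id φ.dom
      g := QFunctor.id φ.cod
      comm := fun _ _ => (Category.id_comp _).trans (Category.comp_id _).symm }
  comp {φ ψ χ} F G :=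
    { f := F.f.comp G.f
      g := G.g.comp F.g
      comm := fun x z => by
        have h1 := G.comm (F.f.toFun x) z
        have h2 := F.comm x (G.g.toFun z)
        calc _ = eqToHom (F.f.extent_eq x) ≫ eqToHom (G.f.extent_eq (F.f.toFun x)) ≫
                χ.dist.arrow (G.f.toFun (F.f.toFun x)) z := by simp [QFunctor.comp]
          _ = _ := by
            rw [h1, ← Category.assoc, h2]
            simp [QFunctor.comp] }

end Quantaloid

section TotalCompleteness

/-- `C` is hypercomplete: a diagram `D : J ⥤ C`, with `J` of any size, has a limit whenever the
limit of `C(A, D -)` exists in sets for all `A`. -/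
def IsHypercomplete.{w₁, w₂, v₁, u₁} (C : Type u₁) [Category.{v₁} C] : Prop :=
  ∀ (J : Type w₁) [Category.{w₂} J] (D : J ⥤ C),
    (∀ A : C, Limits.HasLimit (D ⋙ coyoneda.obj (Opposite.op A))) → Limits.HasLimit D

/-- `C` is totally cocomplete: a diagram `D : J ⥤ C`, with `J` of any size, has a colimit whenever
the colimit of `C(A, D -)` exists in sets for all `A`. -/
def IsTotallyCocomplete.{w₁, w₂, v₁, u₁} (C : Type u₁) [Category.{v₁} C] : Prop :=
  ∀ (J : Type w₁) [Category.{w₂} J] (D : J ⥤ C),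
    (∀ A : C, Limits.HasColimit (D ⋙ coyoneda.obj (Opposite.op A))) → Limits.HasColimit D

/-- The dual of hypercompleteness: a diagram `D` has a colimit whenever the limit of `C(D -, A)`
exists in sets for all `A`. -/
def IsHypercocomplete.{w₁, w₂, v₁, u₁} (C : Type u₁) [Category.{v₁} C] : Prop :=
  ∀ (J : Type w₁) [Category.{w₂} J] (D : J ⥤ C),
    (∀ A : C, Limits.HasLimit (D.op ⋙ yoneda.obj A)) → Limits.HasColimit D

/-- The dual of total cocompleteness: a diagram `D` has a limit whenever the colimit of `C(D -, A)`
exists in sets for all `A`. -/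
def IsTotallyComplete.{w₁, w₂, v₁, u₁} (C : Type u₁) [Category.{v₁} C] : Prop :=
  ∀ (J : Type w₁) [Category.{w₂} J] (D : J ⥤ C),
    (∀ A : C, Limits.HasColimit (D.op ⋙ yoneda.obj A)) → Limits.HasLimit D

end TotalCompleteness

/-! ### Total cocompleteness and hypercompleteness in a general category. -/

section TotalCompleteness

universe w₁ w₂ v₁ u₁ u₂

open Limits Opposite

/-! Everything reduces to total cocompleteness of `Q`-Chu. The category dual to `Q`-Chu is the Chu
category of the opposite quantaloid, so total completeness follows by duality. Hypercompleteness
follows by applying total cocompleteness to the category of cones over a diagram, which may be large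
even when the diagram is small.

The work is done in an equivalent category `FiberedChu` whose `Q`-categories have their objects
grouped by extent, so that no transport along equal extents is needed. A colimit there should be a
distributor from the colimit of the domains to the limit of the codomains. Only size can obstruct
this, and two kinds of test object remove the obstruction. `point s` corepresents the elements of
extent `s` of the domain, so the colimit of these sets exists. Transforms out of `indiscrete Q` are
families of subsets of the codomain; evaluating them embeds the compatible families of codomain
elements into a power of a two-element set, indexed by the colimit given by the hypothesis
(`CodFamily.small`).

The colimit of the domains carries the least hom-arrows making the coprojections functorial. The
residuals of the glued distributor form one competing structure, which gives the distributor law;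
each cocone induces another, which gives the universal property. -/

theorem IsTotallyCocomplete.of_equivalence {C : Type u₁} [Category.{v₁} C] {C' : Type u₂}
    [Category.{v₁} C'] (e : C ≌ C') (h : IsTotallyCocomplete.{w₁, w₂} C) :
    IsTotallyCocomplete.{w₁, w₂} C' := by
  intro J _ D hD
  have : HasColimit (D ⋙ e.inverse) := by
    refine h J (D ⋙ e.inverse) fun A => ?_
    have := hD (e.functor.obj A)
    refine hasColimit_of_iso (F := D ⋙ coyoneda.obj (op (e.functor.obj A))) ?_
    refine NatIso.ofComponents
      (fun j => (e.toAdjunction.homEquiv A (D.obj j)).symm.toIso) fun {j k} m => ?_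
    ext p
    exact e.toAdjunction.homEquiv_naturality_right_symm p (D.map m)
  exact Adjunction.hasColimit_of_comp_equivalence D e.inverse

theorem IsTotallyCocomplete.isTotallyComplete_of_op {C : Type u₁} [Category.{v₁} C]
    (h : IsTotallyCocomplete.{w₁, w₂} Cᵒᵖ) : IsTotallyComplete.{w₁, w₂} C := by
  intro J _ D hD
  have : HasColimit D.op := h Jᵒᵖ D.op fun A =>
    have := hD A.unop
    hasColimit_of_iso (Functor.isoWhiskerLeft D.op (Coyoneda.objOpOp A.unop))
  exact hasLimit_of_hasColimit_op D

theorem IsHypercomplete.isHypercocomplete_of_op {C : Type u₁} [Category.{v₁} C]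
    (h : IsHypercomplete.{w₁, w₂} Cᵒᵖ) : IsHypercocomplete.{w₁, w₂} C := by
  intro J _ D hD
  have : HasLimit D.op := h Jᵒᵖ D.op fun A =>
    have := hD A.unop
    hasLimit_of_iso (Functor.isoWhiskerLeft D.op (Coyoneda.objOpOp A.unop)).symm
  exact hasColimit_of_hasLimit_op D

section ConesOverDiagram

variable {J : Type w₁} [Category.{w₂} J] {C : Type u₁} [Category.{v₁} C] (D : J ⥤ C)

/-- An element of a limit of `C(A, D -)`, seen as a cone over `D` with apex `A`. -/
noncomputable def coneOfLimitCoyoneda (A : C) [HasLimit (D ⋙ coyoneda.obj (op A))]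
    (p : ((limit (D ⋙ coyoneda.obj (op A)) : Type v₁))) : Cone D where
  pt := A
  π :=
    { app := fun j => (limit.π (D ⋙ coyoneda.obj (op A)) j : _ → (A ⟶ D.obj j)) p
      naturality := fun j k m => by
        have := ConcreteCategory.congr_hom (limit.w (D ⋙ coyoneda.obj (op A)) m) p
        exact (Category.id_comp _).trans this.symm }

/-- The natural transformation to `C(A, D -)` from the singleton given by a cone with apex `A`. -/
def punitConeOfCone (A : C) (π : (Functor.const J).obj A ⟶ D) :
    Cone (D ⋙ coyoneda.obj (op A)) where
  pt := PUnit
  π :=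
    { app := fun j => TypeCat.ofHom fun _ => π.app j
      naturality := fun j k m => by
        ext
        exact (Category.id_comp _).symm.trans (π.naturality m) }

/-- A cone over `D` with apex `A`, seen as an element of a limit of `C(A, D -)`. -/
noncomputable def limitCoyonedaOfCone (A : C) [HasLimit (D ⋙ coyoneda.obj (op A))]
    (π : (Functor.const J).obj A ⟶ D) : ((limit (D ⋙ coyoneda.obj (op A)) : Type v₁)) :=
  (limit.lift (D ⋙ coyoneda.obj (op A)) (punitConeOfCone D A π) :
    (PUnit : Type v₁) ⟶ limit (D ⋙ coyoneda.obj (op A))) PUnit.unit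

theorem π_limitCoyonedaOfCone (A : C) [HasLimit (D ⋙ coyoneda.obj (op A))]
    (π : (Functor.const J).obj A ⟶ D) (j : J) :
    limit.π (D ⋙ coyoneda.obj (op A)) j (limitCoyonedaOfCone D A π) = π.app j :=
  ConcreteCategory.congr_hom (limit.lift_π (punitConeOfCone D A π) j) PUnit.unit

theorem limitCoyoneda_ext (A : C) [HasLimit (D ⋙ coyoneda.obj (op A))]
    {p q : ((limit (D ⋙ coyoneda.obj (op A)) : Type v₁))}
    (h : ∀ j, limit.π (D ⋙ coyoneda.obj (op A)) j p = limit.π (D ⋙ coyoneda.obj (op A)) j q) :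
    p = q := by
  have : (TypeCat.ofHom fun _ : PUnit => p) = (TypeCat.ofHom fun _ : PUnit => q) :=
    limit.hom_ext fun j => by
      ext
      exact h j
  exact ConcreteCategory.congr_hom this PUnit.unit

/-- An arrow `h` from `A` to the apex of a cone `c` restricts `c` to a cone with apex `A`, and `h`
is then a map of cones out of this restriction. So in the colimit the class of `h` is that of the
identity of `A` at the restricted cone. The colimit is therefore the set of cones with apex `A`,
which is the limit of `C(A, D -)`. -/
theorem hasColimit_forget_comp_coyoneda (A : C) [HasLimit (D ⋙ coyoneda.obj (op A))] :
    HasColimit (Cone.forget D ⋙ coyoneda.obj (op A)) := by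
  refine ⟨⟨⟨⟨limit (D ⋙ coyoneda.obj (op A)),
    { app := fun c => TypeCat.ofHom fun h : A ⟶ c.pt =>
        limitCoyonedaOfCone D A ((Functor.const J).map h ≫ c.π)
      naturality := fun c c' m => ?_ }⟩, ?_⟩⟩⟩
  · ext h
    refine limitCoyoneda_ext D A fun j => ?_
    refine (π_limitCoyonedaOfCone D A _ j).trans (Eq.trans ?_ (π_limitCoyonedaOfCone D A _ j).symm)
    change (h ≫ m.hom) ≫ c'.π.app j = h ≫ c.π.app j
    exact (Category.assoc _ _ _).trans (congrArg (h ≫ ·) (m.w j))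
  · refine
      { desc := fun s => TypeCat.ofHom fun p => s.ι.app (coneOfLimitCoyoneda D A p) (𝟙 A)
        fac := fun s c => ?_
        uniq := fun s t ht => ?_ }
    · ext h
      let p := limitCoyonedaOfCone D A ((Functor.const J).map h ≫ c.π)
      let m : coneOfLimitCoyoneda D A p ⟶ c :=
        { hom := h
          w := fun j =>
            (π_limitCoyonedaOfCone D A ((Functor.const J).map h ≫ c.π) j).symm }
      have := ConcreteCategory.congr_hom (s.ι.naturality m) (𝟙 A)
      change s.ι.app c (𝟙 A ≫ h) = s.ι.app (coneOfLimitCoyoneda D A p) (𝟙 A) at this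
      change s.ι.app (coneOfLimitCoyoneda D A p) (𝟙 A) = s.ι.app c h
      rw [← this, Category.id_comp]
    · ext p
      have := ConcreteCategory.congr_hom (ht (coneOfLimitCoyoneda D A p)) (𝟙 A)
      refine Eq.trans ?_ this
      refine congrArg t ?_
      refine limitCoyoneda_ext D A fun j => ?_
      refine Eq.trans ?_ (π_limitCoyonedaOfCone D A _ j).symm
      exact (Category.id_comp _).symm

/-- A limit is a terminal cone. The colimit of all apexes is itself the apex of a cone `L`, and the
coprojections are maps of cones into `L`. -/
theorem hasLimit_of_hasColimit_forget [HasColimit (Cone.forget D)] : HasLimit D := by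
  let L : Cone D :=
    { pt := colimit (Cone.forget D)
      π :=
        { app := fun j => colimit.desc (Cone.forget D)
            { pt := D.obj j
              ι :=
                { app := fun c => c.π.app j
                  naturality := fun c c' m => (m.w j).trans (Category.comp_id _).symm } }
          naturality := fun j k m => by
            refine colimit.hom_ext fun c => ?_
            simp only [Functor.const_obj_obj, Functor.const_obj_map, Category.id_comp,
              colimit.ι_desc, colimit.ι_desc_assoc]
            exact (c.w m).symm } }
  let i (c : Cone D) : c ⟶ L :=
    { hom := colimit.ι (Cone.forget D) c
      w := fun j => colimit.ι_desc _ c }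
  -- Each coprojection is itself a map of cones `c ⟶ L`, so following it by the coprojection at `L`
  -- changes nothing. This determines the latter on the whole colimit.
  have hL : (i L).hom = 𝟙 L.pt := by
    refine colimit.hom_ext fun c => ?_
    exact (colimit.w (Cone.forget D) (i c)).trans (Category.comp_id _).symm
  refine ⟨⟨⟨L, { lift := fun c => (i c).hom, fac := fun c j => (i c).w j, uniq := ?_ }⟩⟩⟩
  intro c h hh
  let m : c ⟶ L := { hom := h, w := hh }
  have := colimit.w (Cone.forget D) m
  change h ≫ (i L).hom = (i c).hom at this
  rw [← this, hL, Category.comp_id]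

end ConesOverDiagram

theorem IsTotallyCocomplete.isHypercomplete {C : Type u₁} [Category.{v₁} C]
    (h : IsTotallyCocomplete.{max w₁ u₁ v₁, v₁} C) : IsHypercomplete.{w₁, w₂} C := by
  intro J _ D hD
  have : HasColimit (Cone.forget D) :=
    h (Cone D) (Cone.forget D) fun A => hasColimit_forget_comp_coyoneda D A
  exact hasLimit_of_hasColimit_forget D

end TotalCompleteness

namespace Quantaloid

/-! ### Residuals in a quantaloid, and Chu transforms fibred over extents. -/

section Residuation

variable {Q : Type u} [Quantaloid Q] {r s t : Q}

/-- The largest arrow `c` with `p ≫ c ≤ q`. -/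
def rightResidual (p : r ⟶ s) (q : r ⟶ t) : s ⟶ t := sSup {c | p ≫ c ≤ q}

/-- The largest arrow `c` with `c ≫ p ≤ q`. -/
def leftResidual (p : s ⟶ t) (q : r ⟶ t) : r ⟶ s := sSup {c | c ≫ p ≤ q}

theorem le_rightResidual_iff {p : r ⟶ s} {q : r ⟶ t} {c : s ⟶ t} :
    c ≤ rightResidual p q ↔ p ≫ c ≤ q := by
  refine ⟨fun h => (comp_le_comp le_rfl h).trans ?_, fun h => le_sSup h⟩
  rw [rightResidual, comp_sSup]
  exact iSup₂_le fun _ h => h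

theorem le_leftResidual_iff {p : s ⟶ t} {q : r ⟶ t} {c : r ⟶ s} :
    c ≤ leftResidual p q ↔ c ≫ p ≤ q := by
  refine ⟨fun h => (comp_le_comp h le_rfl).trans ?_, fun h => le_sSup h⟩
  rw [leftResidual, sSup_comp]
  exact iSup₂_le fun _ h => h

end Residuation

/-- A `Q`-category whose objects are grouped by their extent. -/
structure FiberedCat (Q : Type u) [Quantaloid Q] : Type (u + 1) where
  Obj : Q → Type u
  hom {s t : Q} (x : Obj s) (y : Obj t) : s ⟶ t
  id_le {s : Q} (x : Obj s) : 𝟙 s ≤ hom x x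
  comp_le {r s t : Q} (x : Obj r) (y : Obj s) (z : Obj t) : hom x y ≫ hom y z ≤ hom x z

/-- A `Q`-functor, given fibrewise. -/
@[ext]
structure FiberedFunctor {Q : Type u} [Quantaloid Q] (X Y : FiberedCat Q) : Type u where
  toFun (s : Q) : X.Obj s → Y.Obj s
  hom_le {s t : Q} (x : X.Obj s) (y : X.Obj t) : X.hom x y ≤ Y.hom (toFun s x) (toFun t y)

/-- A `Q`-distributor between `Q`-categories whose objects are grouped by their extent. -/
structure FiberedChu (Q : Type u) [Quantaloid Q] : Type (u + 1) where
  dom : FiberedCat Q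
  cod : FiberedCat Q
  arrow {s t : Q} (x : dom.Obj s) (y : cod.Obj t) : s ⟶ t
  hom_arrow_le {r s t : Q} (x' : dom.Obj r) (x : dom.Obj s) (y : cod.Obj t) :
    dom.hom x' x ≫ arrow x y ≤ arrow x' y
  arrow_hom_le {r s t : Q} (x : dom.Obj r) (y : cod.Obj s) (y' : cod.Obj t) :
    arrow x y ≫ cod.hom y y' ≤ arrow x y'

/-- A `Q`-Chu transform, given fibrewise. -/
@[ext]
structure FiberedChuTransform {Q : Type u} [Quantaloid Q] (φ ψ : FiberedChu Q) : Type u where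
  f : FiberedFunctor φ.dom ψ.dom
  g : FiberedFunctor ψ.cod φ.cod
  comm {s t : Q} (x : φ.dom.Obj s) (z : ψ.cod.Obj t) :
    ψ.arrow (f.toFun s x) z = φ.arrow x (g.toFun t z)

namespace FiberedChu

instance category (Q : Type u) [Quantaloid Q] : Category.{u} (FiberedChu Q) where
  Hom φ ψ := FiberedChuTransform φ ψ
  id φ :=
    { f := ⟨fun _ x => x, fun _ _ => le_rfl⟩
      g := ⟨fun _ x => x, fun _ _ => le_rfl⟩
      comm := fun _ _ => rfl }
  comp F G :=
    { f := ⟨fun s x => G.f.toFun s (F.f.toFun s x),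
        fun x y => (F.f.hom_le x y).trans (G.f.hom_le _ _)⟩
      g := ⟨fun s x => F.g.toFun s (G.g.toFun s x),
        fun x y => (G.g.hom_le x y).trans (F.g.hom_le _ _)⟩
      comm := fun x z => (G.comm _ z).trans (F.comm x _) }

variable {Q : Type u} [Quantaloid Q]

theorem hom_ext {φ ψ : FiberedChu Q} {F G : φ ⟶ ψ}
    (hf : ∀ s x, F.f.toFun s x = G.f.toFun s x) (hg : ∀ s x, F.g.toFun s x = G.g.toFun s x) :
    F = G :=
  FiberedChuTransform.ext (FiberedFunctor.ext (funext₂ hf)) (FiberedFunctor.ext (funext₂ hg))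

/-- The fibre over `s` of the domain. -/
def domFiber (s : Q) : FiberedChu Q ⥤ Type u where
  obj φ := φ.dom.Obj s
  map F := TypeCat.ofHom (F.f.toFun s)

/-- The family of sets with a single element, over `s`. -/
inductive Point (s : Q) : Q → Type u
  | pt : Point s s

/-- The distributor from the singleton of extent `s` to its `Q`-category of copresheaves. -/
def point (s : Q) : FiberedChu Q where
  dom :=
    { Obj := Point s
      hom := fun x y => match x, y with
        | .pt, .pt => 𝟙 s
      id_le := by rintro _ ⟨⟩; exact le_rfl
      comp_le := by rintro _ _ _ ⟨⟩ ⟨⟩ ⟨⟩; exact (Category.id_comp _).le }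
  cod :=
    { Obj := fun t => s ⟶ t
      hom := rightResidual
      id_le := fun p => le_rightResidual_iff.2 (Category.comp_id p).le
      comp_le := fun p q r => by
        rw [le_rightResidual_iff, ← Category.assoc]
        exact (comp_le_comp (le_rightResidual_iff.1 le_rfl) le_rfl).trans
          (le_rightResidual_iff.1 le_rfl) }
  arrow := fun x p => match x with
    | .pt => p
  hom_arrow_le := by rintro _ _ _ ⟨⟩ ⟨⟩ p; exact (Category.id_comp _).le
  arrow_hom_le := by rintro _ _ _ ⟨⟩ p q; exact le_rightResidual_iff.1 le_rfl

/-- The transform out of `point s` classifying an element of extent `s`. -/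
def pointHom {s : Q} {φ : FiberedChu Q} (x : φ.dom.Obj s) : point s ⟶ φ where
  f :=
    { toFun := fun _ p => match p with
        | .pt => x
      hom_le := by rintro _ _ ⟨⟩ ⟨⟩; exact φ.dom.id_le x }
  g :=
    { toFun := fun _ z => φ.arrow x z
      hom_le := fun z z' => le_rightResidual_iff.2 (φ.arrow_hom_le x z z') }
  comm := by rintro _ _ ⟨⟩ z; rfl

/-- `point s` corepresents `domFiber s`. -/
def coyonedaPointIso (s : Q) : coyoneda.obj (Opposite.op (point s)) ≅ domFiber s :=
  NatIso.ofComponents (fun φ => Equiv.toIso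
    { toFun := fun F : FiberedChuTransform (point s) φ => F.f.toFun s Point.pt
      invFun := fun x => pointHom x
      -- The arrow of `point s` at `p` is `p` itself, so the Chu condition at the single point
      -- determines the second component.
      left_inv := fun F => hom_ext (by rintro _ ⟨⟩; rfl) (fun _ z => F.comm Point.pt z)
      right_inv := fun x => rfl }) (fun _ => rfl)

/-- The empty distributor into an indiscrete `Q`-category with two objects of each extent. -/
def indiscrete (Q : Type u) [Quantaloid Q] : FiberedChu Q where
  dom :=
    { Obj := fun _ => PEmpty
      hom := fun x => x.elim
      id_le := fun x => x.elim
      comp_le := fun x => x.elim }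
  cod :=
    { Obj := fun _ => ULift Bool
      hom := fun _ _ => ⊤
      id_le := fun _ => le_top
      comp_le := fun _ _ _ => le_top }
  arrow := fun x => x.elim
  hom_arrow_le := fun x => x.elim
  arrow_hom_le := fun x => x.elim

/-- The transform out of `indiscrete Q` given by a family of subsets of the codomain. -/
def indiscreteHom {φ : FiberedChu Q} (p : ∀ s, φ.cod.Obj s → Bool) : indiscrete Q ⟶ φ where
  f := ⟨fun _ x => x.elim, fun x => x.elim⟩
  g := ⟨fun s z => ⟨p s z⟩, fun _ _ => le_top⟩
  comm := fun x => x.elim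

/-! ### Colimits of distributors. -/

section Colimit

open Limits

variable {J : Type w} [Category.{w'} J] (D : J ⥤ FiberedChu Q)

/-- Compatible families of elements of extent `t` of the codomains. -/
def CodFamily (t : Q) : Type (max u w) :=
  {z : ∀ j, (D.obj j).cod.Obj t // ∀ ⦃j k⦄ (m : j ⟶ k), (D.map m).g.toFun t (z k) = z j}

/-- A compatible family `z` is recovered from the function sending the class of `G` to the Boolean
value of `G` at `z j`. This is well defined by compatibility, and singletons separate distinct
families. -/
theorem CodFamily.small [HasColimit (D ⋙ coyoneda.obj (Opposite.op (indiscrete Q)))] (t : Q) :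
    Small.{u} (CodFamily D t) := by
  let F := D ⋙ coyoneda.obj (Opposite.op (indiscrete Q))
  let c (z : CodFamily D t) : Cocone F :=
    { pt := ULift.{u} Bool
      ι :=
        { app := fun j => TypeCat.ofHom fun G : FiberedChuTransform (indiscrete Q) (D.obj j) =>
            G.g.toFun t (z.1 j)
          naturality := fun j k m => by
            ext G
            exact congrArg (FiberedFunctor.toFun (FiberedChuTransform.g G) t) (z.2 m) } }
  have hc (z : CodFamily D t) (j : J) (G : indiscrete Q ⟶ D.obj j) :
      colimit.desc F (c z) (colimit.ι F j G) = G.g.toFun t (z.1 j) :=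
    ConcreteCategory.congr_hom (colimit.ι_desc (c z) j) G
  refine small_of_injective (β := ((colimit F : Type u)) → ULift.{u} Bool)
    (f := fun z => colimit.desc F (c z)) fun z z' h => ?_
  refine Subtype.ext (funext fun j => ?_)
  classical
  -- The indicator of `z j`. It must be defined in every fibre, hence the transport along `s = t`.
  let G : indiscrete Q ⟶ D.obj j :=
    indiscreteHom fun s x => decide (∃ e : s = t, e ▸ x = z.1 j)
  have := congrFun h (colimit.ι F j G)
  dsimp only at this
  rw [hc, hc] at this
  have h2 := congrArg ULift.down this
  simp only [G, indiscreteHom] at h2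
  simpa [eq_comm] using h2

/-- Elements of the colimit of the domains with extent `s`. -/
noncomputable abbrev ColimitDom [∀ s, HasColimit (D ⋙ domFiber s)] (s : Q) : Type u :=
  colimit (D ⋙ domFiber s)

variable [∀ s, HasColimit (D ⋙ domFiber s)]

/-- The coprojection into the colimit of the domains. -/
noncomputable def inj (j : J) {s : Q} (x : (D.obj j).dom.Obj s) : ColimitDom D s :=
  colimit.ι (D ⋙ domFiber s) j x

theorem inj_map {j k : J} (m : j ⟶ k) {s : Q} (x : (D.obj j).dom.Obj s) :
    inj D k ((D.map m).f.toFun s x) = inj D j x :=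
  ConcreteCategory.congr_hom (colimit.w (D ⋙ domFiber s) m) x

theorem exists_inj_eq {s : Q} (x : ColimitDom D s) :
    ∃ (j : J) (x' : (D.obj j).dom.Obj s), inj D j x' = x :=
  Types.jointly_surjective' x

/-- The cocone given by a compatible family of functions. -/
def domCocone {s : Q} {T : Type u} (h : ∀ j, (D.obj j).dom.Obj s → T)
    (hh : ∀ ⦃j k⦄ (m : j ⟶ k) (x), h k ((D.map m).f.toFun s x) = h j x) :
    Cocone (D ⋙ domFiber s) where
  pt := T
  ι :=
    { app := fun j => TypeCat.ofHom (h j)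
      naturality := fun j k m => by
        ext x
        exact hh m x }

/-- The function on the colimit of the domains given by a compatible family of functions. -/
noncomputable def descDom {s : Q} {T : Type u} (h : ∀ j, (D.obj j).dom.Obj s → T)
    (hh : ∀ ⦃j k⦄ (m : j ⟶ k) (x), h k ((D.map m).f.toFun s x) = h j x) : ColimitDom D s → T :=
  colimit.desc (D ⋙ domFiber s) (domCocone D h hh)

theorem descDom_inj {s : Q} {T : Type u} (h : ∀ j, (D.obj j).dom.Obj s → T)
    (hh : ∀ ⦃j k⦄ (m : j ⟶ k) (x), h k ((D.map m).f.toFun s x) = h j x) (j : J)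
    (x : (D.obj j).dom.Obj s) : descDom D h hh (inj D j x) = h j x :=
  ConcreteCategory.congr_hom (colimit.ι_desc (domCocone D h hh) j) x

/-- The `Q`-category structures on the colimit of the domains making the coprojections
`Q`-functors. -/
structure DomStructure where
  hom {s t : Q} (x : ColimitDom D s) (y : ColimitDom D t) : s ⟶ t
  id_le {s : Q} (x : ColimitDom D s) : 𝟙 s ≤ hom x x
  comp_le {r s t : Q} (x : ColimitDom D r) (y : ColimitDom D s) (z : ColimitDom D t) :
    hom x y ≫ hom y z ≤ hom x z
  hom_le (j : J) {s t : Q} (x : (D.obj j).dom.Obj s) (y : (D.obj j).dom.Obj t) :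
    (D.obj j).dom.hom x y ≤ hom (inj D j x) (inj D j y)

/-- The colimit of the domains, with the smallest structure making the coprojections
`Q`-functors. -/
noncomputable def colimitDom : FiberedCat Q where
  Obj := ColimitDom D
  hom x y := ⨅ b : DomStructure D, b.hom x y
  id_le x := le_iInf fun b => b.id_le x
  comp_le x y z := le_iInf fun b =>
    (comp_le_comp (iInf_le _ b) (iInf_le _ b)).trans (b.comp_le x y z)

/-- The limit of the codomains. -/
noncomputable def limitCod [∀ t, Small.{u} (CodFamily D t)] : FiberedCat Q where
  Obj t := Shrink.{u} (CodFamily D t)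
  hom z z' := ⨅ j, (D.obj j).cod.hom (((equivShrink _).symm z).1 j) (((equivShrink _).symm z').1 j)
  id_le _ := le_iInf fun j => (D.obj j).cod.id_le _
  comp_le _ _ _ := le_iInf fun j =>
    (comp_le_comp (iInf_le _ j) (iInf_le _ j)).trans ((D.obj j).cod.comp_le _ _ _)

/-- The distributor from the colimit of the domains to the limit of the codomains. -/
noncomputable def colimitArrow {s t : Q} (x : ColimitDom D s) (z : CodFamily D t) : s ⟶ t :=
  descDom D (fun j x => (D.obj j).arrow x (z.1 j))
    (fun _ _ m _ => by rw [(D.map m).comm, z.2 m]) x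

theorem colimitArrow_inj {s t : Q} (j : J) (x : (D.obj j).dom.Obj s) (z : CodFamily D t) :
    colimitArrow D (inj D j x) z = (D.obj j).arrow x (z.1 j) :=
  descDom_inj D _ _ j x

/-- The largest structure on the colimit of the domains compatible with `colimitArrow`. -/
noncomputable def residualStructure : DomStructure D where
  hom x y := ⨅ (t : Q) (z : CodFamily D t), leftResidual (colimitArrow D y z) (colimitArrow D x z)
  id_le _ := le_iInf₂ fun _ _ => le_leftResidual_iff.2 (Category.id_comp _).le
  comp_le _ _ _ := le_iInf₂ fun t v => le_leftResidual_iff.2 <| by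
    rw [Category.assoc]
    exact (comp_le_comp le_rfl (le_leftResidual_iff.1 (iInf₂_le t v))).trans
      (le_leftResidual_iff.1 (iInf₂_le t v))
  hom_le j s s' x y := le_iInf₂ fun t z => le_leftResidual_iff.2 <| by
    rw [colimitArrow_inj, colimitArrow_inj]
    exact (D.obj j).hom_arrow_le x y _

/-- The family of elements of the codomains given by a cocone. -/
def codFamilyOfCocone (c : Cocone D) {t : Q} (z : c.pt.cod.Obj t) : CodFamily D t :=
  ⟨fun j => (c.ι.app j).g.toFun t z, fun j k m => by
    have := c.w m
    exact congrArg (fun F : FiberedChuTransform _ _ => F.g.toFun t z) this⟩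

/-- The function on the colimit of the domains given by a cocone. -/
noncomputable def descDomOfCocone (c : Cocone D) {s : Q} : ColimitDom D s → c.pt.dom.Obj s :=
  descDom D (fun j => (c.ι.app j).f.toFun s) fun _ _ m x =>
    congrArg (fun F : FiberedChuTransform _ _ => F.f.toFun s x) (c.w m)

theorem descDomOfCocone_inj (c : Cocone D) {s : Q} (j : J) (x : (D.obj j).dom.Obj s) :
    descDomOfCocone D c (inj D j x) = (c.ι.app j).f.toFun s x :=
  descDom_inj D _ _ j x

/-- The structure on the colimit of the domains induced by a cocone. -/
noncomputable def structureOfCocone (c : Cocone D) : DomStructure D where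
  hom x y := c.pt.dom.hom (descDomOfCocone D c x) (descDomOfCocone D c y)
  id_le x := c.pt.dom.id_le _
  comp_le x y z := c.pt.dom.comp_le _ _ _
  hom_le j s t x y := by
    rw [descDomOfCocone_inj, descDomOfCocone_inj]
    exact (c.ι.app j).f.hom_le x y

variable [∀ t, Small.{u} (CodFamily D t)]

/-- The colimit of a diagram of distributors. -/
noncomputable def colimitObj : FiberedChu Q where
  dom := colimitDom D
  cod := limitCod D
  arrow x z := colimitArrow D x ((equivShrink _).symm z)
  -- The hom-arrows of the colimit lie below `residualStructure D`, where the law holds by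
  -- adjunction.
  hom_arrow_le _ _ z := le_leftResidual_iff.1 <|
    (iInf_le _ (residualStructure D)).trans (iInf₂_le _ ((equivShrink _).symm z))
  arrow_hom_le x z z' := by
    obtain ⟨j, x, rfl⟩ := exists_inj_eq D x
    rw [colimitArrow_inj, colimitArrow_inj]
    exact (comp_le_comp le_rfl (iInf_le _ j)).trans ((D.obj j).arrow_hom_le x _ _)

/-- The colimit cocone of a diagram of distributors. -/
noncomputable def colimitCocone : Cocone D where
  pt := colimitObj D
  ι :=
    { app := fun j =>
        { f := ⟨fun _ x => inj D j x, fun x y => le_iInf fun b => b.hom_le j x y⟩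
          g := ⟨fun _ z => ((equivShrink _).symm z).1 j, fun _ _ => iInf_le _ j⟩
          comm := fun x _ => colimitArrow_inj D j x _ }
      naturality := fun _ _ m => hom_ext (fun _ x => inj_map D m x)
        (fun t z => ((equivShrink (CodFamily D t)).symm z).2 m) }

/-- The transform out of the colimit given by a cocone. -/
noncomputable def colimitDesc (c : Cocone D) : colimitObj D ⟶ c.pt where
  -- The least structure lies below the one pulled back along the cocone.
  f := ⟨fun s x => descDomOfCocone D c x, fun x y => iInf_le _ (structureOfCocone D c)⟩
  g := ⟨fun t z => equivShrink _ (codFamilyOfCocone D c z), fun z z' => le_iInf fun j => by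
    rw [Equiv.symm_apply_apply, Equiv.symm_apply_apply]
    exact (c.ι.app j).g.hom_le z z'⟩
  comm x z := by
    obtain ⟨j, x, rfl⟩ := exists_inj_eq D x
    refine Eq.trans ?_ (congrArg (colimitArrow D (inj D j x))
      (Equiv.symm_apply_apply _ (codFamilyOfCocone D c z)).symm)
    rw [colimitArrow_inj]
    exact (congrArg (c.pt.arrow · z) (descDomOfCocone_inj D c j x)).trans
      ((c.ι.app j).comm x z)

/-- `colimitCocone D` is a colimit of `D`. -/
noncomputable def colimitCoconeIsColimit : IsColimit (colimitCocone D) where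
  desc := colimitDesc D
  fac c j := hom_ext (fun s x => descDomOfCocone_inj D c j x) fun t z =>
    congrArg (fun v : CodFamily D t => v.1 j)
      (Equiv.symm_apply_apply _ (codFamilyOfCocone D c z))
  uniq c F hF := hom_ext
    (fun s x => by
      obtain ⟨j, x, rfl⟩ := exists_inj_eq D x
      refine Eq.trans ?_ (descDomOfCocone_inj D c j x).symm
      exact congrArg (fun G : FiberedChuTransform _ _ => G.f.toFun s x) (hF j))
    (fun t z => by
      refine (Equiv.symm_apply_eq _).1 (Subtype.ext (funext fun j => ?_))
      exact congrArg (fun G : FiberedChuTransform _ _ => G.g.toFun t z) (hF j))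

end Colimit

/-- The hypothesis is needed only at the objects `point s` and `indiscrete Q`. -/
theorem isTotallyCocomplete (Q : Type u) [Quantaloid Q] :
    IsTotallyCocomplete.{w, w'} (FiberedChu Q) := by
  intro J _ D hD
  have (s : Q) : Limits.HasColimit (D ⋙ domFiber s) :=
    have := hD (point s)
    Limits.hasColimit_of_iso (Functor.isoWhiskerLeft D (coyonedaPointIso s)).symm
  have := hD (indiscrete Q)
  have (t : Q) : Small.{u} (CodFamily D t) := CodFamily.small D t
  exact ⟨⟨⟨colimitCocone D, colimitCoconeIsColimit D⟩⟩⟩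

end FiberedChu

end Quantaloid

namespace Quantaloid

/-! ### Equivalence of the fibred category with `Q`-Chu. -/

section Total

variable {Q : Type u} [Quantaloid Q]

/-- The `Q`-category of all objects of a fibred `Q`-category. -/
def FiberedCat.total (X : FiberedCat Q) : QCategory Q where
  Obj := Σ s, X.Obj s
  extent := Sigma.fst
  hom x y := X.hom x.2 y.2
  id_le x := X.id_le x.2
  comp_le x y z := X.comp_le x.2 y.2 z.2

/-- The `Q`-functor given by a fibrewise one. -/
def FiberedFunctor.total {X Y : FiberedCat Q} (f : FiberedFunctor X Y) :
    QFunctor X.total Y.total where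
  toFun x := ⟨x.1, f.toFun x.1 x.2⟩
  extent_eq _ := rfl
  hom_le x y := (f.hom_le x.2 y.2).trans
    ((Category.id_comp _).trans (Category.comp_id _)).ge

theorem FiberedFunctor.exists_total_eq {X Y : FiberedCat Q} (F : QFunctor X.total Y.total) :
    ∃ f : FiberedFunctor X Y, f.total = F := by
  obtain ⟨F, hF, hle⟩ := F
  have : ∃ f : ∀ s, X.Obj s → Y.Obj s, F = fun x => ⟨x.1, f x.1 x.2⟩ := by
    have h (s : Q) (x : X.Obj s) : ∃ y : Y.Obj s, F ⟨s, x⟩ = ⟨s, y⟩ := by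
      have h1 : s = (F ⟨s, x⟩).1 := hF ⟨s, x⟩
      -- Once the value is a variable, its extent can be replaced by `s`.
      generalize F ⟨s, x⟩ = y at h1
      obtain ⟨t, y⟩ := y
      obtain rfl : s = t := h1
      exact ⟨y, rfl⟩
    choose f hf using h
    exact ⟨f, funext fun x => hf x.1 x.2⟩
  obtain ⟨f, rfl⟩ := this
  refine ⟨⟨f, fun {s t} x y => (hle ⟨s, x⟩ ⟨t, y⟩).trans ?_⟩, rfl⟩
  exact ((Category.id_comp _).trans (Category.comp_id _)).le

/-- The `Q`-category with objects grouped by their extent. -/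
def QCategory.fibered (X : QCategory Q) : FiberedCat Q where
  Obj s := {x : X.Obj // X.extent x = s}
  hom x y := eqToHom x.2.symm ≫ X.hom x.1 y.1 ≫ eqToHom y.2
  id_le := by
    rintro _ ⟨x, rfl⟩
    simpa using X.id_le x
  comp_le := by
    rintro _ _ _ ⟨x, rfl⟩ ⟨y, rfl⟩ ⟨z, rfl⟩
    simpa using X.comp_le x y z

/-- The comparison of a `Q`-category with its regrouping. -/
def QCategory.ofTotalFibered (X : QCategory Q) : QFunctor X.fibered.total X where
  toFun x := x.2.1
  extent_eq x := x.2.2.symm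
  hom_le _ _ := le_rfl

/-- The comparison of a `Q`-category with its regrouping. -/
def QCategory.toTotalFibered (X : QCategory Q) : QFunctor X X.fibered.total where
  toFun x := ⟨X.extent x, x, rfl⟩
  extent_eq _ := rfl
  hom_le x y := by simp [QCategory.fibered, FiberedCat.total]

theorem QCategory.toTotalFibered_ofTotalFibered (X : QCategory Q) (x : X.fibered.total.Obj) :
    X.toTotalFibered.toFun (X.ofTotalFibered.toFun x) = x := by
  obtain ⟨_, x, rfl⟩ := x
  rfl

theorem QDistributor.hom_arrow_le {X Y : QCategory Q} (φ : QDistributor X Y) (x' x : X.Obj)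
    (y : Y.Obj) : X.hom x' x ≫ φ.arrow x y ≤ φ.arrow x' y := by
  refine le_trans ?_ (φ.comp_le x x' y y)
  refine comp_le_comp le_rfl ?_
  exact (Category.comp_id _).ge.trans (comp_le_comp le_rfl (Y.id_le y))

theorem QDistributor.arrow_hom_le {X Y : QCategory Q} (φ : QDistributor X Y) (x : X.Obj)
    (y y' : Y.Obj) : φ.arrow x y ≫ Y.hom y y' ≤ φ.arrow x y' :=
  ((Category.id_comp _).ge.trans (comp_le_comp (X.id_le x) le_rfl)).trans (φ.comp_le x x y y')

/-- The distributor with the objects of both `Q`-categories grouped by their extent. -/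
def QChu.fibered (φ : QChu Q) : FiberedChu Q where
  dom := φ.dom.fibered
  cod := φ.cod.fibered
  arrow x y := eqToHom x.2.symm ≫ φ.dist.arrow x.1 y.1 ≫ eqToHom y.2
  hom_arrow_le := by
    rintro _ _ _ ⟨x', rfl⟩ ⟨x, rfl⟩ ⟨y, rfl⟩
    simpa [QCategory.fibered] using φ.dist.hom_arrow_le x' x y
  arrow_hom_le := by
    rintro _ _ _ ⟨x, rfl⟩ ⟨y, rfl⟩ ⟨y', rfl⟩
    simpa [QCategory.fibered] using φ.dist.arrow_hom_le x y y'

namespace FiberedChu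

variable (Q) in
/-- The functor forgetting the grouping of objects by their extent. -/
def total : FiberedChu Q ⥤ QChu Q where
  obj φ :=
    { dom := φ.dom.total
      cod := φ.cod.total
      dist :=
        { arrow := fun x y => φ.arrow x.2 y.2
          comp_le := fun x x' y y' =>
            (comp_le_comp le_rfl (φ.arrow_hom_le x.2 y.2 y'.2)).trans
              (φ.hom_arrow_le x'.2 x.2 y'.2) } }
  map F :=
    { f := F.f.total
      g := F.g.total
      comm := fun x z => (Category.id_comp _).trans
        ((F.comm x.2 z.2).trans (Category.comp_id _).symm) }

instance : (total Q).Faithful where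
  map_injective {φ ψ F G} h := by
    refine hom_ext (fun s x => ?_) (fun s x => ?_)
    · have := congrArg (fun T : ChuTransform ((total Q).obj φ) ((total Q).obj ψ) =>
        T.f.toFun ⟨s, x⟩) h
      exact eq_of_heq (Sigma.mk.inj this).2
    · have := congrArg (fun T : ChuTransform ((total Q).obj φ) ((total Q).obj ψ) =>
        T.g.toFun ⟨s, x⟩) h
      exact eq_of_heq (Sigma.mk.inj this).2

instance : (total Q).Full where
  map_surjective {φ ψ} F := by
    obtain ⟨F, G, h⟩ := F
    obtain ⟨f, rfl⟩ := FiberedFunctor.exists_total_eq F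
    obtain ⟨g, rfl⟩ := FiberedFunctor.exists_total_eq G
    exact ⟨⟨f, g, fun {s t} x z => (Category.id_comp _).symm.trans
      ((h ⟨s, x⟩ ⟨t, z⟩).trans (Category.comp_id _))⟩, rfl⟩

instance : (total Q).EssSurj where
  mem_essImage φ := by
    let F : (total Q).obj φ.fibered ⟶ φ :=
      { f := φ.dom.ofTotalFibered
        g := φ.cod.toTotalFibered
        comm := fun x z => 
          (congrArg (eqToHom _ ≫ ·) (Category.comp_id _).symm).trans (Category.comp_id _).symm }
    let G : φ ⟶ (total Q).obj φ.fibered :=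
      { f := φ.dom.toTotalFibered
        g := φ.cod.ofTotalFibered
        comm := fun x z => (Category.id_comp _).trans (Category.id_comp _) }
    refine ⟨φ.fibered, ⟨⟨F, G, ?_, rfl⟩⟩⟩
    exact ChuTransform.ext (QFunctor.ext (funext φ.dom.toTotalFibered_ofTotalFibered))
      (QFunctor.ext (funext φ.cod.toTotalFibered_ofTotalFibered))

instance : (total Q).IsEquivalence where

end FiberedChu

end Total

/-! ### Duality with the opposite quantaloid. -/

section Opposite

open Opposite

variable {Q : Type u} [Quantaloid Q]

/-- The order on the hom-sets of the opposite of a quantaloid. -/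
@[reducible]
def opHomLattice (s t : Qᵒᵖ) : CompleteLattice (s ⟶ t) :=
  { toFun := Quiver.Hom.unop, invFun := Quiver.Hom.op, left_inv := fun _ => rfl,
    right_inv := fun _ => rfl : (s ⟶ t) ≃ (t.unop ⟶ s.unop) }.completeLattice

/-- The opposite of a small quantaloid. -/
instance opposite (Q : Type u) [Quantaloid Q] : Quantaloid Qᵒᵖ where
  homLattice := opHomLattice
  comp_sSup {r s t} p S := by
    let := @opHomLattice Q _
    -- Composition with `p` has a right adjoint, a residual in `Q` on the other side, and hence
    -- preserves suprema.
    have key (q : s ⟶ t) (c : r ⟶ t) : q ≤ (leftResidual p.unop c.unop).op ↔ p ≫ q ≤ c :=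
      le_leftResidual_iff
    refine le_antisymm ((key _ _).1 (sSup_le fun q hq =>
      (key _ _).2 (le_iSup₂ (f := fun q (_ : q ∈ S) => p ≫ q) q hq)))
      (iSup₂_le fun q hq => ?_)
    have h : q ≤ sSup S := le_sSup hq
    have : q.unop ≤ (sSup S).unop := h
    exact comp_le_comp this le_rfl
  sSup_comp {r s t} S p := by
    let := @opHomLattice Q _
    have key (q : r ⟶ s) (c : r ⟶ t) : q ≤ (rightResidual p.unop c.unop).op ↔ q ≫ p ≤ c :=
      le_rightResidual_iff
    refine le_antisymm ((key _ _).1 (sSup_le fun q hq =>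
      (key _ _).2 (le_iSup₂ (f := fun q (_ : q ∈ S) => q ≫ p) q hq)))
      (iSup₂_le fun q hq => ?_)
    have h : q ≤ sSup S := le_sSup hq
    have : q.unop ≤ (sSup S).unop := h
    exact comp_le_comp le_rfl this

/-- The opposite of a fibred `Q`-category. -/
def FiberedCat.op (X : FiberedCat Q) : FiberedCat Qᵒᵖ where
  Obj s := X.Obj s.unop
  hom x y := (X.hom y x).op
  id_le x := X.id_le x
  comp_le x y z := X.comp_le z y x

/-- The fibred `Q`-category with a given opposite. -/
def FiberedCat.unop (X : FiberedCat Qᵒᵖ) : FiberedCat Q where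
  Obj s := X.Obj (Opposite.op s)
  hom x y := (X.hom y x).unop
  id_le x := X.id_le x
  comp_le x y z := X.comp_le z y x

namespace FiberedChu

variable (Q) in
/-- The duality between distributors in a quantaloid and in its opposite. -/
def opFunctor : (FiberedChu Q)ᵒᵖ ⥤ FiberedChu Qᵒᵖ where
  obj φ :=
    { dom := φ.unop.cod.op
      cod := φ.unop.dom.op
      arrow := fun x y => (φ.unop.arrow y x).op
      hom_arrow_le := fun x' x y => φ.unop.arrow_hom_le y x x'
      arrow_hom_le := fun x y y' => φ.unop.hom_arrow_le y' y x }
  map F :=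
    { f := ⟨fun s => F.unop.g.toFun s.unop, fun x y => F.unop.g.hom_le y x⟩
      g := ⟨fun s => F.unop.f.toFun s.unop, fun x y => F.unop.f.hom_le y x⟩
      comm := fun x z => congrArg Quiver.Hom.op (F.unop.comm z x).symm }

instance : (opFunctor Q).Faithful where
  map_injective {φ ψ _ _} h := Quiver.Hom.unop_inj <| hom_ext
    (fun s x => congrArg (fun T : FiberedChuTransform ((opFunctor Q).obj φ) ((opFunctor Q).obj ψ) =>
      T.g.toFun (op s) x) h)
    (fun s x => congrArg (fun T : FiberedChuTransform ((opFunctor Q).obj φ) ((opFunctor Q).obj ψ) =>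
      T.f.toFun (op s) x) h)

instance : (opFunctor Q).Full where
  map_surjective {φ ψ} F :=
    ⟨Quiver.Hom.op (X := ψ.unop) (Y := φ.unop)
      { f := ⟨fun s => F.g.toFun (op s), fun x y => F.g.hom_le y x⟩
        g := ⟨fun s => F.f.toFun (op s), fun x y => F.f.hom_le y x⟩
        comm := fun x z => congrArg Quiver.Hom.unop (F.comm z x).symm }, rfl⟩

instance : (opFunctor Q).EssSurj where
  mem_essImage ψ := ⟨op
    { dom := ψ.cod.unop
      cod := ψ.dom.unop
      arrow := fun x y => (ψ.arrow y x).unop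
      hom_arrow_le := fun x' x y => ψ.arrow_hom_le y x x'
      arrow_hom_le := fun x y y' => ψ.hom_arrow_le y' y x }, ⟨Iso.refl ψ⟩⟩

instance : (opFunctor Q).IsEquivalence where

end FiberedChu

end Opposite

theorem QChu.isTotallyCocomplete (Q : Type u) [Quantaloid Q] :
    IsTotallyCocomplete.{w, w'} (QChu Q) :=
  (FiberedChu.isTotallyCocomplete Q).of_equivalence (FiberedChu.total Q).asEquivalence

/-- Exchanging domain and codomain reverses Chu transforms, so this is the colimit theorem for
`Qᵒᵖ`. -/
theorem QChu.isTotallyCocomplete_op (Q : Type u) [Quantaloid Q] :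
    IsTotallyCocomplete.{w, w'} (QChu Q)ᵒᵖ :=
  (FiberedChu.isTotallyCocomplete Qᵒᵖ).of_equivalence
    ((FiberedChu.opFunctor Q).asEquivalence.symm.trans (FiberedChu.total Q).asEquivalence.op)

end Quantaloid

theorem mainTheorem1 (Q : Type u) [Quantaloid.{u} Q] :
    IsTotallyComplete.{w, w'} (Quantaloid.QChu Q) ∧
      IsTotallyCocomplete.{w, w'} (Quantaloid.QChu Q) ∧
      IsHypercocomplete.{w, w'} (Quantaloid.QChu Q) ∧
      IsHypercomplete.{w, w'} (Quantaloid.QChu Q) :=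
  ⟨(Quantaloid.QChu.isTotallyCocomplete_op Q).isTotallyComplete_of_op,
    Quantaloid.QChu.isTotallyCocomplete Q,
    (Quantaloid.QChu.isTotallyCocomplete_op Q).isHypercomplete.isHypercocomplete_of_op,
    (Quantaloid.QChu.isTotallyCocomplete Q).isHypercomplete⟩
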